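/- **Setting.** Let $N$ be a finite set of players. Each player $n$ has a nonempty finite linearly ordered type space $T_n$ and an action space $A_n\subset\mathbb R$ that is nonempty and either finite or a compact interval. Let $\tilde\Omega=\prod_{i=1}^{\bar k}\tilde\Omega_i$, where each $\tilde\Omega_i\subset\mathbb R$ is nonempty and either finite or a compact interval. All products carry the componentwise order, with $T_{-n}=\prod_{m\ne n}T_m$ and $A_{-n}=\prod_{m\neq n}A_m$. Let $\mathcal P(\tilde\Omega)$ be the set of Borel probability measures on $\tilde\Omega$ with the usual stochastic order: $\mu^1\le\mu^2$ iff $\int q\,d\mu^1\le\int q\,d\mu^2$ for every increasing $q:\tilde\Omega\to\mathbb R$ integrable under both. Write $\mu^1\vee\mu^2$ and $\mu^1\wedge\mu^2$ for the least upper and greatest lower bound in this order. A set $P\subseteq\mathcal P(\tilde\Omega)$ is a *sublattice* if $\mu^1\vee\mu^2$ and $\mu^1\wedge\mu^2$ exist and lie in $P$ for all $\mu^1,\mu^2\in P$. In the *induced set order*, $P^1\le P^2$ means that for all $\mu^1\in P^1$, $\mu^2\in P^2$, the measures $\mu^1\wedge\mu^2$ and $\mu^1\vee\mu^2$ exist,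 with $\mu^1\wedge\mu^2\in P^1$ and $\mu^1\vee\mu^2\in P^2$. A function $f(x,y)$ has *increasing differences* between $x$ and $y$ if $f(x^2,y^1)-f(x^1,y^1)\le f(x^2,y^2)-f(x^1,y^2)$ whenever $x^1\le x^2$, $y^1\le y^2$. **Game.** A special enterprising game $\Gamma$ consists, for all $n$, $t_n\in T_n$, $t_{-n}\in T_{-n}$, of continuous utilities $\tilde u_{n,t_n,t_{-n}}:A_n\times A_{-n}\times\tilde\Omega\to\mathbb R$, a probability vector $p_{n,t_n}=(p_{n,t_n|t_{-n}})_{t_{-n}}$ on $T_{-n}$, sets $\tilde P_{n,t_n,t_{-n}}\subseteq\mathcal P(\tilde\Omega)$ and $\mathcal K_{n,t_n}\subseteq\mathcal P(\tilde\Omega)^{T_{-n}}$ such that $\mathcal Q_{n,t_n}=\big(\prod_{t_{-n}}\tilde P_{n,t_n,t_{-n}}\big)\cap\mathcal K_{n,t_n}$ is nonempty. Against opponents' strategies $a_{-n}=(a_{m,t_m})_{m\ne n,\,t_m\in T_m}$, the satisfaction of player $n$ of type $t_n$ from the action $\alpha\in A_n$ is $$\tilde s_{n,t_n}(\alpha,a_{-n})=\sup_{\nu\in\mathcal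 Q_{n,t_n}}\sum_{t_{-n}\in T_{-n}}p_{n,t_n|t_{-n}}\int_{\tilde\Omega}\tilde u_{n,t_n,t_{-n}}\big(\alpha,(a_{m,t_m})_{m\neq n},\tilde\omega\big)\,\nu_{t_{-n}}(d\tilde\omega).$$ A *pure monotone equilibrium* is a profile $a=(a_n)_n$ of increasing maps $a_n:T_n\to A_n$ such that $a_{n,t_n}$ maximizes $\tilde s_{n,t_n}(\cdot,a_{-n})$ over $A_n$ for all $n$ and $t_n$. Profiles are ordered componentwise. **Monotonic assumptions.** (i) $\tilde u_{n,t_n,t_{-n}}(a_n,a_{-n},\tilde\omega)$ is increasing in $\tilde\omega$. (ii) For each $n$, it has increasing differences between $a_n$ and $(t_n,t_{-n},a_{-n},\tilde\omega)$, and between $(t_n,t_{-n},a_{-n})$ and $\tilde\omega$. (iii) $p_{n,t_n}$ is increasing in $t_n$ in the usual stochastic order. (iv) Each $\tilde P_{n,t_n,t_{-n}}$ is a sublattice. (v) $\tilde P_{n,t_n,t_{-n}}$ is increasing in $t_n$ in the induced set order. *Scenario A*: $p_{n,t_n}$ does not depend on $t_n$, and $\mathcal K_{n,t_n}$ is the set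 of all increasing maps $T_{-n}\to\mathcal P(\tilde\Omega)$. *Scenario B*: $\tilde P_{n,t_n,t_{-n}}$ does not depend on $t_{-n}$, and $\mathcal K_{n,t_n}$ is the set of all constant maps $T_{-n}\to\mathcal P(\tilde\Omega)$. **Theorem.** Let $\Lambda$ be a partially ordered set and $(\Gamma(\lambda))_{\lambda\in\Lambda}$ a family of such games with common $N$, $(T_n)$, $(A_n)$ and $\tilde\Omega$, each satisfying (i)–(v). Suppose that 1. for all $n,t_n,t_{-n},a_{-n}$, the function $\tilde u_{n,t_n,t_{-n}}(a_n,a_{-n},\tilde\omega|\lambda)$ has increasing differences between $(a_n,\tilde\omega)$ and $\lambda$; 2. either all $\Gamma(\lambda)$ are in scenario A and the $p_{n,t_n}(\lambda)$ do not depend on $\lambda$, or all $\Gamma(\lambda)$ are in scenario B and each $p_{n,t_n}(\lambda)$ is increasing in $\lambda$ in the usual stochastic order; 3. each $\tilde P_{n,t_n,t_{-n}}(\lambda)$ is increasing in $\lambda$ in the induced set order. Then every $\Gamma(\lambda)$ has a smallest pure monotone equilibrium $\tilde a_*(\lambda)$ and a largest one $\tilde a^*(\lambda)$, and both are increasing in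 $\lambda$. -/

import Mathlib

open MeasureTheory

noncomputable section

namespace EnterprisingGame

universe x y

/-- `f` has increasing differences between its two arguments. -/
def IncreasingDifferences {X : Type*} {Y : Type*} [Preorder X] [Preorder Y]
    (f : X → Y → ℝ) : Prop :=
  ∀ x₁ x₂ : X, x₁ ≤ x₂ → ∀ y₁ y₂ : Y, y₁ ≤ y₂ →
    f x₂ y₁ - f x₁ y₁ ≤ f x₂ y₂ - f x₁ y₂

/-- A nonempty set of reals that is finite or a compact interval. -/
def IsFiniteOrCompactInterval (s : Set ℝ) : Prop :=
  s.Nonempty ∧ (s.Finite ∨ ∃ a b : ℝ, s = Set.Icc a b)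

/-- The state space: a finite product of sets of reals, with the componentwise order,
the product topology and its Borel sigma-algebra. -/
abbrev State {k : ℕ} (S : Fin k → Set ℝ) : Type := ∀ i : Fin k, S i

/-- Families indexed by the opponents of player `n`. -/
abbrev Opp {N : Type x} (X : N → Type y) (n : N) : Type (max x y) :=
  ∀ m : {m : N // m ≠ n}, X m

section Stochastic

variable {Ω : Type*} [Preorder Ω] [MeasurableSpace Ω]

/-- The usual stochastic order on probability measures. -/
def StochLE (μ₁ μ₂ : ProbabilityMeasure Ω) : Prop :=
  ∀ q : Ω → ℝ, Monotone q → Measurable q →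
    Integrable q (μ₁ : Measure Ω) → Integrable q (μ₂ : Measure Ω) →
      ∫ ω, q ω ∂(μ₁ : Measure Ω) ≤ ∫ ω, q ω ∂(μ₂ : Measure Ω)

/-- `μ` is the join `μ₁ ∨ μ₂`, i.e. the least upper bound in the stochastic order. -/
def IsJoin (μ₁ μ₂ μ : ProbabilityMeasure Ω) : Prop :=
  StochLE μ₁ μ ∧ StochLE μ₂ μ ∧ ∀ ρ, StochLE μ₁ ρ → StochLE μ₂ ρ → StochLE μ ρ

/-- `μ` is the meet `μ₁ ∧ μ₂`, i.e. the greatest lower bound in the stochastic order. -/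
def IsMeet (μ₁ μ₂ μ : ProbabilityMeasure Ω) : Prop :=
  StochLE μ μ₁ ∧ StochLE μ μ₂ ∧ ∀ ρ, StochLE ρ μ₁ → StochLE ρ μ₂ → StochLE ρ μ

/-- The induced set order: `μ₁ ∧ μ₂ ∈ P₁` and `μ₁ ∨ μ₂ ∈ P₂` for `μ₁ ∈ P₁`, `μ₂ ∈ P₂`. -/
def InducedSetLE (P₁ P₂ : Set (ProbabilityMeasure Ω)) : Prop :=
  ∀ μ₁ ∈ P₁, ∀ μ₂ ∈ P₂, (∃ μ ∈ P₁, IsMeet μ₁ μ₂ μ) ∧ (∃ μ ∈ P₂, IsJoin μ₁ μ₂ μ)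

/-- A set of probability measures closed under meets and joins. -/
def IsSublatticeSet (P : Set (ProbabilityMeasure Ω)) : Prop :=
  ∀ μ₁ ∈ P, ∀ μ₂ ∈ P, (∃ μ ∈ P, IsMeet μ₁ μ₂ μ) ∧ (∃ μ ∈ P, IsJoin μ₁ μ₂ μ)

/-- The monotone maps from an ordered set to the stochastically ordered measures. -/
def monotoneMaps (X : Type*) [Preorder X] (Ω : Type*) [Preorder Ω] [MeasurableSpace Ω] :
    Set (X → ProbabilityMeasure Ω) :=
  {ν | ∀ t₁ t₂ : X, t₁ ≤ t₂ → StochLE (ν t₁) (ν t₂)}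

/-- The constant maps to the probability measures. -/
def constantMaps (X : Type*) (Ω : Type*) [MeasurableSpace Ω] :
    Set (X → ProbabilityMeasure Ω) :=
  {ν | ∃ μ, ∀ t, ν t = μ}

end Stochastic

/-- The `l`-weighted sum of every monotone `f` is at most the `l'`-weighted one. -/
def WeightLE {X : Type*} [Fintype X] [Preorder X] (l l' : X → ℝ) : Prop :=
  ∀ f : X → ℝ, Monotone f → ∑ t, l t * f t ≤ ∑ t, l' t * f t

variable {N : Type x} [Fintype N] [DecidableEq N]
  {T : N → Type y} [∀ n, Fintype (T n)] [∀ n, LinearOrder (T n)]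
  {A : N → Set ℝ} {k : ℕ} {S : Fin k → Set ℝ}

/-- A special enterprising game with players `N`, type spaces `T n`, action spaces `A n` and
state space `State S`. -/
structure SpecialGame (N : Type x) [Fintype N] [DecidableEq N]
    (T : N → Type y) [∀ n, Fintype (T n)] [∀ n, LinearOrder (T n)]
    (A : N → Set ℝ) {k : ℕ} (S : Fin k → Set ℝ) where
  /-- payoff-utility of own type, opponents' types, own action, opponents' actions, state -/
  u : ∀ n, T n → Opp T n → A n → Opp (fun m => A m) n → State S → ℝ
  /-- belief of a player of a given type on the opponents' types -/
  p : ∀ n, T n → Opp T n → ℝ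
  /-- componentwise prior sets -/
  P : ∀ n, T n → Opp T n → Set (ProbabilityMeasure (State S))
  /-- joint restriction on the prior vectors -/
  K : ∀ n, T n → Set (Opp T n → ProbabilityMeasure (State S))
  continuous_u : ∀ n tn t, Continuous
    (fun z : A n × Opp (fun m => A m) n × State S => u n tn t z.1 z.2.1 z.2.2)
  p_nonneg : ∀ n tn t, 0 ≤ p n tn t
  p_sum : ∀ n tn, ∑ t, p n tn t = 1
  exists_prior : ∀ n tn, ∃ ν ∈ K n tn, ∀ t, ν t ∈ P n tn t

namespace SpecialGame

variable (G : SpecialGame N T A S)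

/-- The set of prior vectors entertained by player `n` of type `tn`. -/
def Q (n : N) (tn : T n) : Set (Opp T n → ProbabilityMeasure (State S)) :=
  {ν | ∀ t, ν t ∈ G.P n tn t} ∩ G.K n tn

/-- Expected utility given all types, all actions and a state distribution. -/
def v (n : N) (tn : T n) (t : Opp T n) (an : A n) (b : Opp (fun m => A m) n)
    (μ : ProbabilityMeasure (State S)) : ℝ :=
  ∫ ω, G.u n tn t an b ω ∂(μ : Measure (State S))

/-- Expected utility given own type, own action, opponents' strategies and a prior vector. -/
def w (n : N) (tn : T n) (an : A n) (b : Opp (fun m => T m → A m) n)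
    (ν : Opp T n → ProbabilityMeasure (State S)) : ℝ :=
  ∑ t, G.p n tn t * G.v n tn t an (fun m => b m (t m)) (ν t)

/-- The satisfaction of the optimistic player: the supremum over the prior vectors. -/
def s (n : N) (tn : T n) (an : A n) (b : Opp (fun m => T m → A m) n) : ℝ :=
  sSup ((fun ν => G.w n tn an b ν) '' G.Q n tn)

/-- Best-response actions of player `n` of type `tn`. -/
def bestActions (n : N) (tn : T n) (b : Opp (fun m => T m → A m) n) : Set (A n) :=
  {an | ∀ an' : A n, G.s n tn an' b ≤ G.s n tn an b}

/-- Monotone best-response strategies of player `n` against monotone strategies. -/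
def bestStrategies (n : N) (b : Opp (fun m => T m →o A m) n) : Set (T n →o A n) :=
  {a | ∀ tn, a tn ∈ G.bestActions n tn (fun m => b m)}

/-- The joint best-response correspondence on profiles of monotone strategies. -/
def bestProfiles (a : ∀ n, T n →o A n) : Set (∀ n, T n →o A n) :=
  {a' | ∀ n, a' n ∈ G.bestStrategies n (fun m => a m)}

/-- The pure monotone equilibria, ordered componentwise. -/
def equilibria : Set (∀ n, T n →o A n) :=
  {a | a ∈ G.bestProfiles a}

/-- Higher states give higher utility; the utility has increasing differences between own
action and everything else, and between (types, opponents' actions) and the state; beliefs are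
stochastically monotone in own type; the prior sets are sublattices increasing in own type. -/
structure MonotonicAssumptions : Prop where
  mono_state : ∀ n tn t an b, Monotone (fun ω => G.u n tn t an b ω)
  incr_action : ∀ n, IncreasingDifferences
    (fun (an : A n) (e : T n × Opp T n × Opp (fun m => A m) n × State S) =>
      G.u n e.1 e.2.1 an e.2.2.1 e.2.2.2)
  incr_state : ∀ n (an : A n), IncreasingDifferences
    (fun (e : T n × Opp T n × Opp (fun m => A m) n) (ω : State S) =>
      G.u n e.1 e.2.1 an e.2.2 ω)
  mono_belief : ∀ n (t₁ t₂ : T n), t₁ ≤ t₂ → WeightLE (G.p n t₁) (G.p n t₂)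
  sublattice : ∀ n tn t, IsSublatticeSet (G.P n tn t)
  mono_prior : ∀ n (t : Opp T n) (t₁ t₂ : T n), t₁ ≤ t₂ →
    InducedSetLE (G.P n t₁ t) (G.P n t₂ t)

/-- Scenario A: beliefs do not depend on own type, and the prior vectors are the monotone
selections of the prior sets. -/
structure ScenarioA : Prop where
  belief : ∀ n (t₁ t₂ : T n), G.p n t₁ = G.p n t₂
  restriction : ∀ n tn, G.K n tn = monotoneMaps (Opp T n) (State S)

/-- Scenario B: the prior sets do not depend on the opponents' types, and the prior vectors
are constant. -/
structure ScenarioB : Prop where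
  prior : ∀ n tn (t t' : Opp T n), G.P n tn t = G.P n tn t'
  restriction : ∀ n tn, G.K n tn = constantMaps (Opp T n) (State S)

end SpecialGame

end EnterprisingGame

end

/-!
The satisfaction of a player has increasing differences between the own action and the triple
(parameter, own type, opponents' strategies). By Topkis' argument the smallest and the largest best
replies increase in that triple, so they are again monotone strategies, and the two best-reply maps
are monotone on the complete lattice of profiles of monotone strategies and increase in the
parameter. The extreme equilibria are the least and the greatest fixed points of these maps, and
extreme fixed points of monotone maps increase with the map.
-/

open Filter Topology

namespace EnterprisingGame

section Order

theorem isLeast_lfp_of_isLeast {α : Type*} [CompleteLattice α] {B : α → Set α} {f : α →o α}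
    (hf : ∀ a, IsLeast (B a) (f a)) : IsLeast {a | a ∈ B a} f.lfp := by
  have hfix : f.lfp ∈ B f.lfp := by simpa only [f.map_lfp] using (hf f.lfp).1
  exact ⟨hfix, fun a ha => f.lfp_le ((hf a).2 ha)⟩

theorem isGreatest_gfp_of_isGreatest {α : Type*} [CompleteLattice α] {B : α → Set α}
    {f : α →o α} (hf : ∀ a, IsGreatest (B a) (f a)) : IsGreatest {a | a ∈ B a} f.gfp := by
  have hfix : f.gfp ∈ B f.gfp := by simpa only [f.map_gfp] using (hf f.gfp).1
  exact ⟨hfix, fun a ha => f.le_gfp ((hf a).2 ha)⟩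

theorem exists_isGLB_of_compactSpace {α : Type*} [LinearOrder α] [TopologicalSpace α]
    [OrderClosedTopology α] [CompactSpace α] [Nonempty α] (s : Set α) : ∃ x, IsGLB s x := by
  obtain ⟨b, -, hb⟩ := isCompact_univ.exists_isLeast (Set.univ_nonempty (α := α))
  have hclosed : IsClosed (lowerBounds s) := by
    simp only [lowerBounds, Set.ofPred_forall]
    exact isClosed_biInter fun _ _ => isClosed_Iic
  exact hclosed.isCompact.exists_isGreatest ⟨b, fun x _ => hb (Set.mem_univ x)⟩

/-- The complete lattice structure of a nonempty compact linear order, with the given order. -/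
noncomputable abbrev completeLatticeOfCompactSpace (α : Type*) [LinearOrder α] [TopologicalSpace α]
    [OrderClosedTopology α] [CompactSpace α] [Nonempty α] : CompleteLattice α :=
  letI : InfSet α := ⟨fun s => (exists_isGLB_of_compactSpace s).choose⟩
  completeLatticeOfInf α fun s => (exists_isGLB_of_compactSpace s).choose_spec

theorem isCompact_argmax {α β : Type*} [TopologicalSpace α] [CompactSpace α] [Preorder β]
    [TopologicalSpace β] [ClosedIciTopology β] {f : α → β} (hf : Continuous f) :
    IsCompact {x | ∀ z, f z ≤ f x} := by
  rw [Set.ofPred_forall]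
  exact (isClosed_iInter fun z => isClosed_Ici.preimage hf).isCompact

theorem isLeast_argmax_le {α : Type*} [LinearOrder α] {f g : α → ℝ}
    (hfg : Monotone fun a => g a - f a) {x y : α} (hx : IsLeast {a | ∀ z, f z ≤ f a} x)
    (hy : ∀ z, g z ≤ g y) : x ≤ y := by
  by_contra! hyx
  have hgain : g y - f y ≤ g x - f x := hfg hyx.le
  have hfy : f x ≤ f y := by linarith [hy x]
  exact hyx.not_ge (hx.2 fun z => (hx.1 z).trans hfy)

theorem le_isGreatest_argmax {α : Type*} [LinearOrder α] {f g : α → ℝ}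
    (hfg : Monotone fun a => g a - f a) {x y : α} (hx : ∀ z, f z ≤ f x)
    (hy : IsGreatest {a | ∀ z, g z ≤ g a} y) : x ≤ y := by
  by_contra! hyx
  have hgain : g y - f y ≤ g x - f x := hfg hyx.le
  have hgx : g y ≤ g x := by linarith [hx y]
  exact hyx.not_ge (hy.2 fun z => (hy.1 z).trans hgx)

theorem exists_orderHom_coe_eq {Λ α N : Type*} {T B : N → Type*} [Preorder Λ] [Preorder α]
    [∀ n, Preorder (T n)] [∀ n, Preorder (B n)] (r : Λ → α → ∀ n, T n → B n)
    (hr : ∀ ⦃l₁ l₂⦄, l₁ ≤ l₂ → ∀ ⦃a₁ a₂⦄, a₁ ≤ a₂ → ∀ ⦃n⦄ ⦃t₁ t₂ : T n⦄, t₁ ≤ t₂ →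
      r l₁ a₁ n t₁ ≤ r l₂ a₂ n t₂) :
    ∃ f : Λ →o α →o ∀ n, T n →o B n, ∀ l a n, ⇑(f l a n) = r l a n :=
  ⟨⟨fun l => ⟨fun a n => ⟨r l a n, fun _ _ ht => hr le_rfl le_rfl ht⟩,
    fun _ _ ha _ _ => hr le_rfl ha le_rfl⟩, fun _ _ hl _ _ _ => hr hl le_rfl le_rfl⟩,
    fun _ _ _ => rfl⟩

end Order

section StochasticOrder

theorem tendsto_integral_truncate {Ω : Type*} [MeasurableSpace Ω] {μ : Measure Ω} {q : Ω → ℝ}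
    (hq : Integrable q μ) :
    Tendsto (fun n : ℕ => ∫ ω, max (-n : ℝ) (min n (q ω)) ∂μ) atTop (𝓝 (∫ ω, q ω ∂μ)) := by
  refine tendsto_integral_of_dominated_convergence (fun ω => |q ω|)
    (fun n => (aestronglyMeasurable_const.sup (aestronglyMeasurable_const.inf hq.1))) hq.abs
    (fun n => ae_of_all _ fun ω => ?_) (ae_of_all _ fun ω => ?_)
  · have hn : (0 : ℝ) ≤ n := n.cast_nonneg
    rw [Real.norm_eq_abs, abs_le]
    grind
  · obtain ⟨m, hm⟩ := exists_nat_ge |q ω|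
    refine tendsto_const_nhds.congr' ((eventually_ge_atTop m).mono fun n hn => ?_)
    have hqn : |q ω| ≤ n := hm.trans (Nat.cast_le.2 hn)
    simp only [min_eq_right (abs_le.1 hqn).2, max_eq_right (abs_le.1 hqn).1]

variable {Ω : Type*} [Preorder Ω] [MeasurableSpace Ω]

theorem StochLE.refl (μ : ProbabilityMeasure Ω) : StochLE μ μ := fun _ _ _ _ _ => le_rfl

-- A test function need not be integrable under `μ₂`, so it is truncated first.
theorem StochLE.trans {μ₁ μ₂ μ₃ : ProbabilityMeasure Ω} (h₁₂ : StochLE μ₁ μ₂)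
    (h₂₃ : StochLE μ₂ μ₃) : StochLE μ₁ μ₃ := by
  intro q hq hqm hq₁ hq₃
  refine le_of_tendsto_of_tendsto' (tendsto_integral_truncate hq₁)
    (tendsto_integral_truncate hq₃) fun n => ?_
  have hmono : Monotone fun ω => max (-n : ℝ) (min n (q ω)) :=
    monotone_const.max (monotone_const.min hq)
  have hmeas : Measurable fun ω => max (-n : ℝ) (min n (q ω)) := by fun_prop
  have hint (μ : ProbabilityMeasure Ω) :
      Integrable (fun ω => max (-n : ℝ) (min n (q ω))) (μ : Measure Ω) :=
    Integrable.of_mem_Icc (-n) n hmeas.aemeasurable <| ae_of_all _ fun ω =>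
      ⟨le_max_left _ _, max_le (neg_le_self n.cast_nonneg) (min_le_left _ _)⟩
  exact (h₁₂ _ hmono hmeas (hint _) (hint _)).trans (h₂₃ _ hmono hmeas (hint _) (hint _))

theorem WeightLE.of_eq {X : Type*} [Fintype X] [Preorder X] {p₁ p₂ : X → ℝ} (h : p₁ = p₂) :
    WeightLE p₁ p₂ := fun _ _ => h ▸ le_rfl

theorem constantMaps_subset_monotoneMaps (X : Type*) [Preorder X] :
    constantMaps X Ω ⊆ monotoneMaps X Ω := by
  rintro ν ⟨μ, hμ⟩ t₁ t₂ -
  rw [hμ t₁, hμ t₂]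
  exact StochLE.refl μ

/-- The part of the induced set order that matters to an optimistic player, for sets of prior
vectors: a member of `Q₁` and a member of `Q₂` have a common upper bound in `Q₂`, which need not
be a join. -/
def DirectedLE {X : Type*} (Q₁ Q₂ : Set (X → ProbabilityMeasure Ω)) : Prop :=
  ∀ ν₁ ∈ Q₁, ∀ ν₂ ∈ Q₂, ∃ ν ∈ Q₂, (∀ t, StochLE (ν₁ t) (ν t)) ∧ ∀ t, StochLE (ν₂ t) (ν t)

theorem DirectedLE.trans {X : Type*} {Q₁ Q₂ Q₃ : Set (X → ProbabilityMeasure Ω)}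
    (h₁₂ : DirectedLE Q₁ Q₂) (h₂₃ : DirectedLE Q₂ Q₃) (hne : Q₂.Nonempty) : DirectedLE Q₁ Q₃ := by
  intro ν₁ hν₁ ν₃ hν₃
  obtain ⟨ν₂, hν₂⟩ := hne
  obtain ⟨ν, hν, hν₁ν, -⟩ := h₁₂ ν₁ hν₁ ν₂ hν₂
  obtain ⟨ρ, hρ, hνρ, hν₃ρ⟩ := h₂₃ ν hν ν₃ hν₃
  exact ⟨ρ, hρ, fun t => (hν₁ν t).trans (hνρ t), hν₃ρ⟩

theorem directedLE_inter_monotoneMaps {X : Type*} [Preorder X]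
    {P₁ P₂ : X → Set (ProbabilityMeasure Ω)} (hP : ∀ t, InducedSetLE (P₁ t) (P₂ t)) :
    DirectedLE ({ν | ∀ t, ν t ∈ P₁ t} ∩ monotoneMaps X Ω)
      ({ν | ∀ t, ν t ∈ P₂ t} ∩ monotoneMaps X Ω) := by
  rintro ν₁ ⟨hν₁, hmono₁⟩ ν₂ ⟨hν₂, hmono₂⟩
  choose ν hν hjoin using fun t => (hP t _ (hν₁ t) _ (hν₂ t)).2
  have hmono : ν ∈ monotoneMaps X Ω := fun t t' htt' => (hjoin t).2.2 _
    ((hmono₁ t t' htt').trans (hjoin t').1) ((hmono₂ t t' htt').trans (hjoin t').2.1)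
  exact ⟨ν, ⟨hν, hmono⟩, fun t => (hjoin t).1, fun t => (hjoin t).2.1⟩

theorem directedLE_inter_constantMaps {X : Type*} {P₁ P₂ : X → Set (ProbabilityMeasure Ω)}
    (hconst : ∀ t t', P₂ t = P₂ t') (hP : ∀ t, InducedSetLE (P₁ t) (P₂ t)) :
    DirectedLE ({ν | ∀ t, ν t ∈ P₁ t} ∩ constantMaps X Ω)
      ({ν | ∀ t, ν t ∈ P₂ t} ∩ constantMaps X Ω) := by
  rintro ν₁ ⟨hν₁, μ₁, hμ₁⟩ ν₂ ⟨hν₂, μ₂, hμ₂⟩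
  obtain rfl : ν₁ = fun _ => μ₁ := funext hμ₁
  obtain rfl : ν₂ = fun _ => μ₂ := funext hμ₂
  rcases isEmpty_or_nonempty X with _ | ⟨⟨t₀⟩⟩
  · exact ⟨_, ⟨hν₂, μ₂, hμ₂⟩, isEmptyElim, isEmptyElim⟩
  obtain ⟨μ, hμ, hjoin⟩ := (hP t₀ _ (hν₁ t₀) _ (hν₂ t₀)).2
  exact ⟨fun _ => μ, ⟨fun t => hconst t₀ t ▸ hμ, μ, fun _ => rfl⟩, fun _ => hjoin.1,
    fun _ => hjoin.2.1⟩

end StochasticOrder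

section Satisfaction

variable {X Ω : Type*} [Fintype X] [TopologicalSpace Ω] [MeasurableSpace Ω]

/-- The expected value of a type-contingent payoff `g` on the state space, under a belief `p` on
the types and a prior vector `ν`. -/
noncomputable def expectedPayoff (p : X → ℝ) (ν : X → ProbabilityMeasure Ω) (g : X → C(Ω, ℝ)) : ℝ :=
  ∑ t, p t * ∫ ω, g t ω ∂(ν t : Measure Ω)

/-- The optimistic value of a type-contingent payoff: the supremum of its expected values over a set
`Q` of prior vectors. -/
noncomputable def satisfaction (p : X → ℝ) (Q : Set (X → ProbabilityMeasure Ω))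
    (g : X → C(Ω, ℝ)) : ℝ :=
  sSup ((fun ν => expectedPayoff p ν g) '' Q)

variable [CompactSpace Ω] {p p₁ p₂ : X → ℝ}

theorem expectedPayoff_le_norm (hp : p ∈ stdSimplex ℝ X) (ν : X → ProbabilityMeasure Ω)
    (g : X → C(Ω, ℝ)) : expectedPayoff p ν g ≤ ‖g‖ := by
  have hint (t : X) : ∫ ω, g t ω ∂(ν t : Measure Ω) ≤ ‖g‖ := by
    refine (Real.le_norm_self _).trans ?_
    simpa using norm_integral_le_of_norm_le_const (μ := (ν t : Measure Ω))
      (ae_of_all _ fun ω => ((g t).norm_coe_le_norm ω).trans (norm_le_pi_norm g t))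
  calc expectedPayoff p ν g
      ≤ ∑ t, p t * ‖g‖ :=
        Finset.sum_le_sum fun t _ => mul_le_mul_of_nonneg_left (hint t) (hp.1 t)
    _ = ‖g‖ := by rw [← Finset.sum_mul, hp.2, one_mul]

theorem expectedPayoff_le_satisfaction (hp : p ∈ stdSimplex ℝ X)
    {Q : Set (X → ProbabilityMeasure Ω)} {ν : X → ProbabilityMeasure Ω} (hν : ν ∈ Q)
    (g : X → C(Ω, ℝ)) : expectedPayoff p ν g ≤ satisfaction p Q g :=
  le_csSup ⟨‖g‖, Set.forall_mem_image.2 fun ν _ => expectedPayoff_le_norm hp ν g⟩ ⟨ν, hν, rfl⟩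

variable [OpensMeasurableSpace Ω]

theorem integrable_continuousMap (g : C(Ω, ℝ)) (μ : ProbabilityMeasure Ω) :
    Integrable g (μ : Measure Ω) :=
  (BoundedContinuousFunction.mkOfCompact g).integrable _

theorem expectedPayoff_sub (p : X → ℝ) (ν : X → ProbabilityMeasure Ω) (g h : X → C(Ω, ℝ)) :
    expectedPayoff p ν (g - h) = expectedPayoff p ν g - expectedPayoff p ν h := by
  simp only [expectedPayoff, Pi.sub_apply, ContinuousMap.sub_apply, ← Finset.sum_sub_distrib,
    ← mul_sub, integral_sub (integrable_continuousMap _ _) (integrable_continuousMap _ _)]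

theorem lipschitzWith_satisfaction (hp : p ∈ stdSimplex ℝ X)
    {Q : Set (X → ProbabilityMeasure Ω)} (hQ : Q.Nonempty) :
    LipschitzWith 1 (satisfaction p Q) := by
  refine LipschitzWith.of_le_add fun g h => csSup_le (hQ.image _) ?_
  rintro _ ⟨ν, hν, rfl⟩
  have hdist : expectedPayoff p ν g - expectedPayoff p ν h ≤ dist g h := by
    rw [← expectedPayoff_sub, dist_eq_norm]
    exact expectedPayoff_le_norm hp ν _
  linarith [expectedPayoff_le_satisfaction hp hν h]

theorem expectedPayoff_mono_right (hp : 0 ≤ p) (ν : X → ProbabilityMeasure Ω)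
    {g h : X → C(Ω, ℝ)} (hgh : g ≤ h) : expectedPayoff p ν g ≤ expectedPayoff p ν h :=
  Finset.sum_le_sum fun t _ => mul_le_mul_of_nonneg_left
    (integral_mono (integrable_continuousMap _ _) (integrable_continuousMap _ _) (hgh t)) (hp t)

variable [Preorder Ω]

theorem expectedPayoff_mono_prior (hp : 0 ≤ p) {ν₁ ν₂ : X → ProbabilityMeasure Ω}
    (hν : ∀ t, StochLE (ν₁ t) (ν₂ t)) {g : X → C(Ω, ℝ)} (hg : ∀ t, Monotone (g t)) :
    expectedPayoff p ν₁ g ≤ expectedPayoff p ν₂ g :=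
  Finset.sum_le_sum fun t _ => mul_le_mul_of_nonneg_left
    (hν t _ (hg t) (g t).continuous.measurable (integrable_continuousMap _ _)
      (integrable_continuousMap _ _)) (hp t)

variable [Preorder X]

theorem expectedPayoff_mono_belief (hp : WeightLE p₁ p₂) {ν : X → ProbabilityMeasure Ω}
    (hν : ν ∈ monotoneMaps X Ω) {g : X → C(Ω, ℝ)} (hg : Monotone g)
    (hgt : ∀ t, Monotone (g t)) : expectedPayoff p₁ ν g ≤ expectedPayoff p₂ ν g := by
  refine hp _ fun t t' htt' => ?_
  have hint := integrable_continuousMap (Ω := Ω)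
  calc ∫ ω, g t ω ∂(ν t : Measure Ω)
      ≤ ∫ ω, g t ω ∂(ν t' : Measure Ω) :=
        hν t t' htt' _ (hgt t) (g t).continuous.measurable (hint _ _) (hint _ _)
    _ ≤ ∫ ω, g t' ω ∂(ν t' : Measure Ω) := integral_mono (hint _ _) (hint _ _) (hg htt')

-- A common upper bound `ν ∈ Q₂` of `ν₁ ∈ Q₁` and `ν₂ ∈ Q₂` raises the gain from `g₁` to `h₁`
-- evaluated at `ν₁`, and the value of `g₂` at `ν₂`.
theorem satisfaction_sub_le_satisfaction_sub (hp₁ : p₁ ∈ stdSimplex ℝ X)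
    (hp₂ : p₂ ∈ stdSimplex ℝ X) (hp : WeightLE p₁ p₂) {Q₁ Q₂ : Set (X → ProbabilityMeasure Ω)}
    (hne₁ : Q₁.Nonempty) (hne₂ : Q₂.Nonempty) (hQ₁ : Q₁ ⊆ monotoneMaps X Ω)
    (hQ : DirectedLE Q₁ Q₂) {g₁ h₁ g₂ h₂ : X → C(Ω, ℝ)} (hgain : h₁ - g₁ ≤ h₂ - g₂)
    (hgain_type : Monotone (h₁ - g₁)) (hgain_state : ∀ t, Monotone ((h₁ - g₁) t))
    (hg₂ : ∀ t, Monotone (g₂ t)) :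
    satisfaction p₁ Q₁ h₁ - satisfaction p₁ Q₁ g₁ ≤
      satisfaction p₂ Q₂ h₂ - satisfaction p₂ Q₂ g₂ := by
  have hpair : ∀ ν₁ ∈ Q₁, ∀ ν₂ ∈ Q₂, expectedPayoff p₁ ν₁ h₁ + expectedPayoff p₂ ν₂ g₂ ≤
      satisfaction p₁ Q₁ g₁ + satisfaction p₂ Q₂ h₂ := by
    intro ν₁ hν₁ ν₂ hν₂
    obtain ⟨ν, hν, hν₁ν, hν₂ν⟩ := hQ ν₁ hν₁ ν₂ hν₂
    have hgain_le := calc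
      expectedPayoff p₁ ν₁ h₁ - expectedPayoff p₁ ν₁ g₁
      _ = expectedPayoff p₁ ν₁ (h₁ - g₁) := (expectedPayoff_sub _ _ _ _).symm
      _ ≤ expectedPayoff p₂ ν₁ (h₁ - g₁) :=
        expectedPayoff_mono_belief hp (hQ₁ hν₁) hgain_type hgain_state
      _ ≤ expectedPayoff p₂ ν (h₁ - g₁) := expectedPayoff_mono_prior hp₂.1 hν₁ν hgain_state
      _ ≤ expectedPayoff p₂ ν (h₂ - g₂) := expectedPayoff_mono_right hp₂.1 ν hgain
      _ = expectedPayoff p₂ ν h₂ - expectedPayoff p₂ ν g₂ := expectedPayoff_sub _ _ _ _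
    linarith [expectedPayoff_mono_prior hp₂.1 hν₂ν hg₂,
      expectedPayoff_le_satisfaction hp₁ hν₁ g₁, expectedPayoff_le_satisfaction hp₂ hν h₂]
  have hsum : satisfaction p₁ Q₁ h₁ + satisfaction p₂ Q₂ g₂ ≤
      satisfaction p₁ Q₁ g₁ + satisfaction p₂ Q₂ h₂ := by
    rw [← le_sub_iff_add_le]
    refine csSup_le (hne₁.image _) (Set.forall_mem_image.2 fun ν₁ hν₁ => ?_)
    rw [le_sub_comm]
    refine csSup_le (hne₂.image _) (Set.forall_mem_image.2 fun ν₂ hν₂ => ?_)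
    linarith [hpair ν₁ hν₁ ν₂ hν₂]
  linarith

end Satisfaction

theorem IsFiniteOrCompactInterval.isCompact {s : Set ℝ} (hs : IsFiniteOrCompactInterval s) :
    IsCompact s := by
  obtain ⟨-, hfin | ⟨a, b, rfl⟩⟩ := hs
  · exact hfin.isCompact
  · exact isCompact_Icc

namespace SpecialGame

variable {N : Type*} [Fintype N] [DecidableEq N]
  {T : N → Type*} [∀ n, Fintype (T n)] [∀ n, LinearOrder (T n)]
  {A : N → Set ℝ} {k : ℕ} {S : Fin k → Set ℝ}

section BestActions

variable (G : SpecialGame N T A S) {n : N} (tn : T n)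

theorem p_mem_stdSimplex : G.p n tn ∈ stdSimplex ℝ (Opp T n) :=
  ⟨G.p_nonneg n tn, G.p_sum n tn⟩

theorem nonempty_Q : (G.Q n tn).Nonempty := by
  obtain ⟨ν, hK, hP⟩ := G.exists_prior n tn
  exact ⟨ν, hP, hK⟩

/-- The utility from an action against given strategies, as a continuous function of the state for
each type profile of the opponents. -/
def payoff (an : A n) (b : Opp (fun m => T m → A m) n) : Opp T n → C(State S, ℝ) :=
  fun t => ⟨G.u n tn t an fun m => b m (t m), (G.continuous_u n tn t).comp
    (by fun_prop : Continuous fun ω => (an, (fun m => b m (t m)), ω))⟩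

theorem s_eq_satisfaction (an : A n) (b : Opp (fun m => T m → A m) n) :
    G.s n tn an b = satisfaction (G.p n tn) (G.Q n tn) (G.payoff tn an b) :=
  rfl

theorem continuous_payoff (b : Opp (fun m => T m → A m) n) :
    Continuous fun an => G.payoff tn an b :=
  continuous_pi fun t => (ContinuousMap.curry
    ⟨fun z : A n × State S => G.u n tn t z.1 (fun m => b m (t m)) z.2,
      (G.continuous_u n tn t).comp (by fun_prop :
        Continuous fun z : A n × State S => (z.1, (fun m => b m (t m)), z.2))⟩).continuous

variable [∀ i, CompactSpace (S i)]

theorem continuous_s (b : Opp (fun m => T m → A m) n) : Continuous fun an => G.s n tn an b := by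
  simp only [s_eq_satisfaction]
  exact (lipschitzWith_satisfaction (G.p_mem_stdSimplex tn) (G.nonempty_Q tn)).continuous.comp
    (G.continuous_payoff tn b)

variable [CompactSpace (A n)]

theorem isCompact_bestActions (b : Opp (fun m => T m → A m) n) :
    IsCompact (G.bestActions n tn b) :=
  isCompact_argmax (G.continuous_s tn b)

theorem nonempty_bestActions [Nonempty (A n)] (b : Opp (fun m => T m → A m) n) :
    (G.bestActions n tn b).Nonempty := by
  obtain ⟨an, -, han⟩ := isCompact_univ.exists_isMaxOn Set.univ_nonempty
    (G.continuous_s tn b).continuousOn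
  exact ⟨an, fun an' => han (Set.mem_univ an')⟩

end BestActions

variable {Λ : Type*} [Preorder Λ]

/-- A family of games in which the parameter and the own type both raise the gain from a higher
action, with beliefs and sets of prior vectors increasing in the pair (parameter, own type). The
fields `subset_monotoneMaps` and `directed_Q` extract what scenarios A and B have in common. -/
structure MonotoneFamily (G : Λ → SpecialGame N T A S) : Prop where
  mono_state : ∀ l n tn t an b, Monotone ((G l).u n tn t an b)
  incr_action : ∀ n, IncreasingDifferences
    (fun (an : A n) (e : (Λ × T n) × Opp T n × Opp (fun m => A m) n × State S) =>
      (G e.1.1).u n e.1.2 e.2.1 an e.2.2.1 e.2.2.2)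
  mono_belief : ∀ n (i j : Λ × T n), i ≤ j → WeightLE ((G i.1).p n i.2) ((G j.1).p n j.2)
  subset_monotoneMaps : ∀ l n tn, (G l).Q n tn ⊆ monotoneMaps (Opp T n) (State S)
  directed_Q : ∀ n (i j : Λ × T n), i ≤ j → DirectedLE ((G i.1).Q n i.2) ((G j.1).Q n j.2)

namespace MonotoneFamily

variable {G : Λ → SpecialGame N T A S} [∀ i, CompactSpace (S i)]

theorem monotone_s_sub (hG : MonotoneFamily G) {l₁ l₂ : Λ} (hl : l₁ ≤ l₂) {n : N} {t₁ t₂ : T n}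
    (ht : t₁ ≤ t₂) {b₁ b₂ : Opp (fun m => T m →o A m) n} (hb : b₁ ≤ b₂) :
    Monotone fun an => (G l₂).s n t₂ an (fun m => b₂ m) - (G l₁).s n t₁ an (fun m => b₁ m) := by
  intro x y hxy
  have hsub := satisfaction_sub_le_satisfaction_sub ((G l₁).p_mem_stdSimplex t₁)
    ((G l₂).p_mem_stdSimplex t₂) (hG.mono_belief n (l₁, t₁) (l₂, t₂) ⟨hl, ht⟩)
    ((G l₁).nonempty_Q t₁) ((G l₂).nonempty_Q t₂) (hG.subset_monotoneMaps l₁ n t₁)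
    (hG.directed_Q n (l₁, t₁) (l₂, t₂) ⟨hl, ht⟩)
    (g₁ := (G l₁).payoff t₁ x fun m => b₁ m) (h₁ := (G l₁).payoff t₁ y fun m => b₁ m)
    (g₂ := (G l₂).payoff t₂ x fun m => b₂ m) (h₂ := (G l₂).payoff t₂ y fun m => b₂ m)
    (fun t ω => hG.incr_action n x y hxy ((l₁, t₁), t, (fun m => b₁ m (t m)), ω)
      ((l₂, t₂), t, (fun m => b₂ m (t m)), ω) ⟨⟨hl, ht⟩, le_rfl, fun m => hb m (t m), le_rfl⟩)
    (fun t t' htt' ω => hG.incr_action n x y hxy ((l₁, t₁), t, (fun m => b₁ m (t m)), ω)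
      ((l₁, t₁), t', (fun m => b₁ m (t' m)), ω)
      ⟨le_rfl, htt', fun m => (b₁ m).monotone (htt' m), le_rfl⟩)
    (fun t ω ω' hω => hG.incr_action n x y hxy ((l₁, t₁), t, (fun m => b₁ m (t m)), ω)
      ((l₁, t₁), t, (fun m => b₁ m (t m)), ω') ⟨le_rfl, le_rfl, le_rfl, hω⟩)
    (fun t => hG.mono_state l₂ n t₂ t x _)
  simp only [s_eq_satisfaction]
  linarith

variable [∀ n, CompactSpace (A n)] [∀ n, Nonempty (A n)]

theorem exists_orderHom_isLeast_bestProfiles (hG : MonotoneFamily G) :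
    ∃ f : Λ →o (∀ n, T n →o A n) →o ∀ n, T n →o A n,
      ∀ l a, IsLeast ((G l).bestProfiles a) (f l a) := by
  choose r hr using fun l (a : ∀ n, T n →o A n) n (tn : T n) =>
    ((G l).isCompact_bestActions tn fun m => a m).exists_isLeast
      ((G l).nonempty_bestActions tn _)
  have hmono ⦃l₁ l₂ : Λ⦄ (hl : l₁ ≤ l₂) ⦃a₁ a₂ : ∀ n, T n →o A n⦄ (ha : a₁ ≤ a₂) ⦃n : N⦄
      ⦃t₁ t₂ : T n⦄ (ht : t₁ ≤ t₂) : r l₁ a₁ n t₁ ≤ r l₂ a₂ n t₂ :=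
    isLeast_argmax_le (hG.monotone_s_sub hl ht fun m => ha m) (hr l₁ a₁ n t₁) (hr l₂ a₂ n t₂).1
  obtain ⟨f, hf⟩ := exists_orderHom_coe_eq r hmono
  refine ⟨f, fun l a => ⟨fun n tn => ?_, fun a' ha' n tn => ?_⟩⟩
  · exact hf l a n ▸ (hr l a n tn).1
  · exact hf l a n ▸ (hr l a n tn).2 (ha' n tn)

theorem exists_orderHom_isGreatest_bestProfiles (hG : MonotoneFamily G) :
    ∃ f : Λ →o (∀ n, T n →o A n) →o ∀ n, T n →o A n,
      ∀ l a, IsGreatest ((G l).bestProfiles a) (f l a) := by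
  choose r hr using fun l (a : ∀ n, T n →o A n) n (tn : T n) =>
    ((G l).isCompact_bestActions tn fun m => a m).exists_isGreatest
      ((G l).nonempty_bestActions tn _)
  have hmono ⦃l₁ l₂ : Λ⦄ (hl : l₁ ≤ l₂) ⦃a₁ a₂ : ∀ n, T n →o A n⦄ (ha : a₁ ≤ a₂) ⦃n : N⦄
      ⦃t₁ t₂ : T n⦄ (ht : t₁ ≤ t₂) : r l₁ a₁ n t₁ ≤ r l₂ a₂ n t₂ :=
    le_isGreatest_argmax (hG.monotone_s_sub hl ht fun m => ha m) (hr l₁ a₁ n t₁).1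
      (hr l₂ a₂ n t₂)
  obtain ⟨f, hf⟩ := exists_orderHom_coe_eq r hmono
  refine ⟨f, fun l a => ⟨fun n tn => ?_, fun a' ha' n tn => ?_⟩⟩
  · exact hf l a n ▸ (hr l a n tn).1
  · exact hf l a n ▸ (hr l a n tn).2 (ha' n tn)

end MonotoneFamily

theorem MonotoneFamily.of_scenarios {G : Λ → SpecialGame N T A S}
    (hmono : ∀ l, (G l).MonotonicAssumptions)
    (hutility : ∀ n tn t (b : Opp (fun m => A m) n) ω,
      IncreasingDifferences fun (an : A n) (l : Λ) => (G l).u n tn t an b ω)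
    (hscenario : (∀ l, (G l).ScenarioA) ∨ ∀ l, (G l).ScenarioB)
    (hbelief : ∀ n tn (l₁ l₂ : Λ), l₁ ≤ l₂ → WeightLE ((G l₁).p n tn) ((G l₂).p n tn))
    (hprior : ∀ n tn t (l₁ l₂ : Λ), l₁ ≤ l₂ → InducedSetLE ((G l₁).P n tn t) ((G l₂).P n tn t)) :
    MonotoneFamily G where
  mono_state l := (hmono l).mono_state
  incr_action := by
    rintro n x y hxy ⟨⟨l₁, t₁⟩, t, b, ω⟩ ⟨⟨l₂, t₂⟩, t', b', ω'⟩ ⟨⟨hl, ht⟩, h⟩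
    exact ((hmono l₁).incr_action n x y hxy (t₁, t, b, ω) (t₂, t', b', ω') ⟨ht, h⟩).trans
      (hutility n t₂ t' b' ω' x y hxy l₁ l₂ hl)
  mono_belief := by
    rintro n ⟨l₁, t₁⟩ ⟨l₂, t₂⟩ ⟨hl, ht⟩ f hf
    exact ((hmono l₁).mono_belief n t₁ t₂ ht f hf).trans (hbelief n t₂ l₁ l₂ hl f hf)
  subset_monotoneMaps l n tn := by
    rcases hscenario with hA | hB
    · exact Set.inter_subset_right.trans ((hA l).restriction n tn).subset
    · exact Set.inter_subset_right.trans
        (((hB l).restriction n tn).subset.trans (constantMaps_subset_monotoneMaps _))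
  directed_Q := by
    have hQ {n} {l₁ l₂ : Λ} {t₁ t₂ : T n}
        (hP : ∀ t, InducedSetLE ((G l₁).P n t₁ t) ((G l₂).P n t₂ t)) :
        DirectedLE ((G l₁).Q n t₁) ((G l₂).Q n t₂) := by
      rcases hscenario with hA | hB
      · simp only [Q, (hA _).restriction]
        exact directedLE_inter_monotoneMaps hP
      · simp only [Q, (hB _).restriction]
        exact directedLE_inter_constantMaps ((hB l₂).prior n t₂) hP
    rintro n ⟨l₁, t₁⟩ ⟨l₂, t₂⟩ ⟨hl, ht⟩
    exact (hQ fun t => (hmono l₁).mono_prior n t t₁ t₂ ht).trans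
      (hQ fun t => hprior n t₂ t l₁ l₂ hl) ((G l₁).nonempty_Q t₂)

end SpecialGame

end EnterprisingGame

theorem theorem8_general {N : Type*} [Fintype N] [DecidableEq N]
    {T : N → Type*} [∀ n, Fintype (T n)] [∀ n, LinearOrder (T n)]
    {A : N → Set ℝ} (hA : ∀ n, IsCompact (A n)) (hA_nonempty : ∀ n, (A n).Nonempty)
    {k : ℕ} {S : Fin k → Set ℝ} (hS : ∀ i, IsCompact (S i))
    {Λ : Type*} [Preorder Λ] {G : Λ → EnterprisingGame.SpecialGame N T A S}
    (hG : EnterprisingGame.SpecialGame.MonotoneFamily G) :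
    ∃ aMin aMax : Λ → ∀ n, T n →o A n,
      (∀ l, IsLeast (G l).equilibria (aMin l)) ∧
      (∀ l, IsGreatest (G l).equilibria (aMax l)) ∧
      Monotone aMin ∧ Monotone aMax := by
  have (n : N) : CompactSpace (A n) := isCompact_iff_compactSpace.1 (hA n)
  have (n : N) : Nonempty (A n) := (hA_nonempty n).to_subtype
  have (i : Fin k) : CompactSpace (S i) := isCompact_iff_compactSpace.1 (hS i)
  let (n : N) : CompleteLattice (A n) := EnterprisingGame.completeLatticeOfCompactSpace (A n)
  obtain ⟨lo, hlo⟩ := hG.exists_orderHom_isLeast_bestProfiles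
  obtain ⟨hi, hhi⟩ := hG.exists_orderHom_isGreatest_bestProfiles
  exact ⟨fun l => (lo l).lfp, fun l => (hi l).gfp,
    fun l => EnterprisingGame.isLeast_lfp_of_isLeast (hlo l),
    fun l => EnterprisingGame.isGreatest_gfp_of_isGreatest (hhi l),
    OrderHom.lfp.monotone.comp lo.monotone, OrderHom.gfp.monotone.comp hi.monotone⟩

theorem theorem8 {N : Type*} [Fintype N] [DecidableEq N]
    {T : N → Type*} [∀ n, Fintype (T n)] [∀ n, LinearOrder (T n)] [∀ n, Nonempty (T n)]
    {A : N → Set ℝ} (hA : ∀ n, EnterprisingGame.IsFiniteOrCompactInterval (A n))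
    {k : ℕ} {S : Fin k → Set ℝ} (hS : ∀ i, EnterprisingGame.IsFiniteOrCompactInterval (S i))
    {Λ : Type*} [PartialOrder Λ]
    (G : Λ → EnterprisingGame.SpecialGame N T A S)
    (hmono : ∀ l, (G l).MonotonicAssumptions)
    (hutility : ∀ n tn t (b : EnterprisingGame.Opp (fun m => A m) n),
      EnterprisingGame.IncreasingDifferences
        (fun (e : A n × EnterprisingGame.State S) (l : Λ) => (G l).u n tn t e.1 b e.2))
    (hscenario :
      ((∀ l, (G l).ScenarioA) ∧ ∀ (l₁ l₂ : Λ) n tn, (G l₁).p n tn = (G l₂).p n tn) ∨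
      ((∀ l, (G l).ScenarioB) ∧ ∀ (l₁ l₂ : Λ), l₁ ≤ l₂ → ∀ n tn,
        EnterprisingGame.WeightLE ((G l₁).p n tn) ((G l₂).p n tn)))
    (hprior : ∀ n tn t (l₁ l₂ : Λ), l₁ ≤ l₂ →
      EnterprisingGame.InducedSetLE ((G l₁).P n tn t) ((G l₂).P n tn t)) :
    ∃ aMin aMax : Λ → ∀ n, T n →o A n,
      (∀ l, IsLeast (G l).equilibria (aMin l)) ∧
      (∀ l, IsGreatest (G l).equilibria (aMax l)) ∧
      Monotone aMin ∧ Monotone aMax := by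
  exact theorem8_general (fun n => (hA n).isCompact) (fun n => (hA n).1)
    (fun i => (hS i).isCompact) (.of_scenarios hmono
      (fun n tn t b ω x y hxy => hutility n tn t b (x, ω) (y, ω) ⟨hxy, le_rfl⟩)
      (hscenario.imp And.left And.left)
      (fun n tn l₁ l₂ hl => hscenario.elim (fun h => .of_eq (h.2 l₁ l₂ n tn))
        fun h => h.2 l₁ l₂ hl n tn) hprior)
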